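/- **Corollary 4.12.** For a tensor $T\in\mathbb R^{n_1}\otimes\mathbb R^{n_2}\otimes\mathbb R^{n_3}$, let the (real) subrank $Q(T)$ be the largest integer $r\ge 0$ for which there exist $\mathbb R$-linear maps $\varphi_i:\mathbb R^{n_i}\to\mathbb R^r$ $(i=1,2,3)$ with $$(\varphi_1\otimes\varphi_2\otimes\varphi_3)\,T=\sum_{j=1}^r e_j\otimes e_j\otimes e_j .$$ An integer $r\ge 0$ is called a *typical subrank* of real $n_1\times n_2\times n_3$ tensors if the set $\{T\in\mathbb R^{n_1}\otimes\mathbb R^{n_2}\otimes\mathbb R^{n_3} : Q(T)=r\}$ contains a nonempty subset that is open in the Euclidean topology. The typical subranks of real $3\times4\times4$ tensors are exactly $2$ and $3$. -/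

import Mathlib

open scoped TensorProduct

/-- The `r`-th unit tensor `∑ j, e_j ⊗ e_j ⊗ e_j` in `k^r ⊗ k^r ⊗ k^r`. -/
noncomputable def unitTensor (k : Type*) [Field k] (r : ℕ) :
    ((Fin r → k) ⊗[k] (Fin r → k)) ⊗[k] (Fin r → k) :=
  ∑ j : Fin r, (Pi.single j (1 : k) ⊗ₜ[k] Pi.single j (1 : k)) ⊗ₜ[k] Pi.single j (1 : k)

/-- `T` restricts to the `r`-th unit tensor: there are linear maps `φᵢ : Vᵢ → k^r` with
`(φ₁ ⊗ φ₂ ⊗ φ₃) T = I_r`. -/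
def RestrictsToUnit {k V₁ V₂ V₃ : Type*} [Field k]
    [AddCommGroup V₁] [Module k V₁] [AddCommGroup V₂] [Module k V₂]
    [AddCommGroup V₃] [Module k V₃] (T : (V₁ ⊗[k] V₂) ⊗[k] V₃) (r : ℕ) : Prop :=
  ∃ (φ₁ : V₁ →ₗ[k] (Fin r → k)) (φ₂ : V₂ →ₗ[k] (Fin r → k)) (φ₃ : V₃ →ₗ[k] (Fin r → k)),
    TensorProduct.map (TensorProduct.map φ₁ φ₂) φ₃ T = unitTensor k r

/-- The subrank of a tensor of order three: the largest `r` such that `T` restricts to the `r`-th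
unit tensor. The maximum exists by `subrank_isGreatest` below. -/
noncomputable def subrank {k V₁ V₂ V₃ : Type*} [Field k]
    [AddCommGroup V₁] [Module k V₁] [AddCommGroup V₂] [Module k V₂]
    [AddCommGroup V₃] [Module k V₃] (T : (V₁ ⊗[k] V₂) ⊗[k] V₃) : ℕ :=
  sSup {r : ℕ | RestrictsToUnit T r}

theorem RestrictsToUnit.le_finrank {k V₁ V₂ V₃ : Type*} [Field k]
    [AddCommGroup V₁] [Module k V₁] [AddCommGroup V₂] [Module k V₂]
    [AddCommGroup V₃] [Module k V₃] [FiniteDimensional k V₃]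
    {T : (V₁ ⊗[k] V₂) ⊗[k] V₃} {r : ℕ} (h : RestrictsToUnit T r) :
    r ≤ Module.finrank k V₃ := by
  obtain ⟨φ₁, φ₂, φ₃, h⟩ := h
  -- contraction of the first two factors with the coordinate functional `e_i* ⊗ e_i*`
  let c (i : Fin r) : ((Fin r → k) ⊗[k] (Fin r → k)) →ₗ[k] k :=
    LinearMap.mul' k k ∘ₗ TensorProduct.map (LinearMap.proj i) (LinearMap.proj i)
  let C (i : Fin r) : (((Fin r → k) ⊗[k] (Fin r → k)) ⊗[k] (Fin r → k)) →ₗ[k] (Fin r → k) :=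
    (TensorProduct.lid k (Fin r → k)).toLinearMap ∘ₗ (c i).rTensor (Fin r → k)
  have hrange (i : Fin r) (S : (V₁ ⊗[k] V₂) ⊗[k] V₃) :
      C i (TensorProduct.map (TensorProduct.map φ₁ φ₂) φ₃ S) ∈ LinearMap.range φ₃ := by
    induction S using TensorProduct.induction_on with
    | zero => simp
    | add x y hx hy => rw [map_add, map_add]; exact add_mem hx hy
    | tmul x y =>
      refine ⟨c i (TensorProduct.map φ₁ φ₂ x) • y, ?_⟩
      simp [C]
  have hunit (i : Fin r) : C i (unitTensor k r) = Pi.single i (1 : k) := by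
    simp [C, c, unitTensor, Pi.single_apply]
  have hsurj : Function.Surjective φ₃ := by
    rw [← LinearMap.range_eq_top, eq_top_iff, ← (Pi.basisFun k (Fin r)).span_eq,
      Submodule.span_le]
    rintro _ ⟨i, rfl⟩
    have := hrange i T
    rw [h, hunit] at this
    simpa using this
  simpa using LinearMap.finrank_le_finrank_of_surjective hsurj

/-- For finite-dimensional spaces, the subrank is a genuine maximum. -/
theorem subrank_isGreatest {k V₁ V₂ V₃ : Type*} [Field k]
    [AddCommGroup V₁] [Module k V₁] [AddCommGroup V₂] [Module k V₂]
    [AddCommGroup V₃] [Module k V₃] [FiniteDimensional k V₃]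
    (T : (V₁ ⊗[k] V₂) ⊗[k] V₃) :
    IsGreatest {r : ℕ | RestrictsToUnit T r} (subrank T) := by
  have hb : BddAbove {r : ℕ | RestrictsToUnit T r} :=
    ⟨Module.finrank k V₃, fun _ hr => hr.le_finrank⟩
  have hn : {r : ℕ | RestrictsToUnit T r}.Nonempty := by
    refine ⟨0, 0, 0, 0, ?_⟩
    simp [unitTensor]
  exact ⟨Nat.sSup_mem hn hb, fun _ hr => le_csSup hb hr⟩

/-- The space `ℝ^n₁ ⊗ ℝ^n₂ ⊗ ℝ^n₃` of real `n₁ × n₂ × n₃` tensors. It carries Mathlib's inner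
product on tensor products of inner product spaces, hence the Euclidean topology. -/
abbrev RealTensor (n₁ n₂ n₃ : ℕ) : Type :=
  (EuclideanSpace ℝ (Fin n₁) ⊗[ℝ] EuclideanSpace ℝ (Fin n₂)) ⊗[ℝ] EuclideanSpace ℝ (Fin n₃)

/-- `r` is a typical subrank of real `n₁ × n₂ × n₃` tensors: the set of tensors with (real)
subrank `r` contains a nonempty open set. -/
def IsTypicalSubrank (n₁ n₂ n₃ r : ℕ) : Prop :=
  ∃ U : Set (RealTensor n₁ n₂ n₃), IsOpen U ∧ U.Nonempty ∧ U ⊆ {T | subrank T = r}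

/-!
The inner product with pure tensors turns a tensor `T` into a trilinear form, and `T` restricts to
the `r`-th unit tensor iff there are vectors `x a`, `y b`, `z c` pulling this form back to the unit
tensor.

* If the `r²` functionals `T (x a, ·, z c)` are linearly independent, the equations for the `y b`
  can be solved, also after a small perturbation of `T`. Adding generic multiples of a fixed tensor
  makes the functionals independent, so a generic `3 × 4 × 4` tensor has subrank at least two, while
  independence of the `x a` bounds the subrank by three.
* Subrank three occurs on an open set by the implicit function theorem, at a tensor where the
  equations for the `x a`, `y b` and `z c` jointly have surjective derivative.
* Suppose that no `T (x, ·, ·)` with `x ≠ 0` is degenerate; this is an open condition, and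
  quaternion multiplication provides such a `T`. For fixed `a`, the `r` vectors `y b` are orthogonal
  under `T (x a, ·, ·)` to the `r - 1` vectors `z c` with `c ≠ a`, so `2 r - 1 ≤ 4` and `r ≤ 2`.
-/

-- Nested tensor products and spaces of continuous linear maps need this depth in instance search.
set_option maxSynthPendingDepth 3

section UnitSystem

variable {k M₁ M₂ M₃ ι : Type*} [Field k] [AddCommGroup M₁] [Module k M₁]
  [AddCommGroup M₂] [Module k M₂] [AddCommGroup M₃] [Module k M₃]

/-- The vectors `x a`, `y b`, `z c` pull the trilinear form `f` back to the unit tensor. For the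
trilinear form of a tensor `T`, such families are the rows of the maps restricting `T` to the unit
tensor. -/
def IsUnitSystem [DecidableEq ι] (f : M₁ →ₗ[k] M₂ →ₗ[k] M₃ →ₗ[k] k) (x : ι → M₁) (y : ι → M₂)
    (z : ι → M₃) : Prop :=
  ∀ a b c, f (x a) (y b) (z c) = if a = b ∧ b = c then 1 else 0

/-- Every nonzero first argument turns the trilinear form `f` into a bilinear form that is
nondegenerate in the last variable. When `M₂` and `M₃` have the same dimension this is the absolute
nonsingularity of the tensor: no nontrivial combination of its slices is singular. -/
def IsNonsingular (f : M₁ →ₗ[k] M₂ →ₗ[k] M₃ →ₗ[k] k) : Prop :=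
  ∀ x ≠ 0, (f x).SeparatingRight

theorem linearIndependent_of_pairing [DecidableEq ι] {v : ι → M₁} {φ : ι → Module.Dual k M₁}
    (h : ∀ i j, φ i (v j) = if i = j then 1 else 0) : LinearIndependent k v := by
  have hcomp : LinearMap.pi φ ∘ v = fun j => Pi.single j 1 := by
    ext j i
    simp [h, Pi.single_apply]
  refine LinearIndependent.of_comp (LinearMap.pi φ) ?_
  rw [hcomp]
  exact Pi.linearIndependent_single_one ι k

theorem card_add_card_le_finrank [FiniteDimensional k M₁] {κ : Type*} [Fintype ι] [Fintype κ]
    {v : ι → M₁} {φ : κ → Module.Dual k M₁} (hv : LinearIndependent k v)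
    (hφ : LinearIndependent k φ) (h : ∀ i j, φ j (v i) = 0) :
    Fintype.card ι + Fintype.card κ ≤ Module.finrank k M₁ := by
  have hle : Submodule.span k (Set.range φ) ≤
      (Submodule.span k (Set.range v)).dualAnnihilator := by
    rw [Submodule.span_le, Set.range_subset_iff]
    intro j
    rw [SetLike.mem_coe, Submodule.mem_dualAnnihilator]
    have hker : Submodule.span k (Set.range v) ≤ LinearMap.ker (φ j) :=
      Submodule.span_le.2 (Set.range_subset_iff.2 fun i => h i j)
    exact hker
  have hcard := Submodule.finrank_mono hle
  rw [finrank_span_eq_card hφ] at hcard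
  rw [← Subspace.finrank_add_finrank_dualAnnihilator_eq (Submodule.span k (Set.range v)),
    finrank_span_eq_card hv]
  exact Nat.add_le_add_left hcard _

namespace IsUnitSystem

variable [DecidableEq ι] {f : M₁ →ₗ[k] M₂ →ₗ[k] M₃ →ₗ[k] k} {x : ι → M₁} {y : ι → M₂} {z : ι → M₃}

theorem comp_injective {κ : Type*} [DecidableEq κ] (h : IsUnitSystem f x y z) {g : κ → ι}
    (hg : Function.Injective g) : IsUnitSystem f (x ∘ g) (y ∘ g) (z ∘ g) := fun a b c => by
  simp [h (g a) (g b) (g c), hg.eq_iff]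

theorem linearIndependent_left (h : IsUnitSystem f x y z) : LinearIndependent k x :=
  linearIndependent_of_pairing (φ := fun i => (f.flip (y i)).flip (z i)) fun i j => by
    simp [h j i i, eq_comm]

theorem linearIndependent_middle (h : IsUnitSystem f x y z) : LinearIndependent k y :=
  linearIndependent_of_pairing (φ := fun i => (f (x i)).flip (z i)) fun i j => by
    simp [h i j i, eq_comm (a := j)]

theorem linearIndependent_right (h : IsUnitSystem f x y z) : LinearIndependent k z :=
  linearIndependent_of_pairing (φ := fun i => f (x i) (y i)) fun i j => by
    simp [h i i j]

/-- Fix an index `a`. Since `f (x a) (y b) (z c) = 0` for all `b` and all `c ≠ a`, the vectors `z c`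
with `c ≠ a` give `card ι - 1` independent functionals vanishing on all `y b`. -/
theorem two_mul_card_le [Fintype ι] [FiniteDimensional k M₂] (h : IsUnitSystem f x y z)
    (hf : IsNonsingular f) : 2 * Fintype.card ι ≤ Module.finrank k M₂ + 1 := by
  rcases isEmpty_or_nonempty ι with _ | ⟨⟨a⟩⟩
  · simp
  have hker : LinearMap.ker (f (x a)).flip = ⊥ :=
    LinearMap.separatingRight_iff_flip_ker_eq_bot.1 (hf _ (h.linearIndependent_left.ne_zero a))
  have hindep : LinearIndependent k fun c : {c // c ≠ a} => (f (x a)).flip (z c) :=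
    (h.linearIndependent_right.comp _ Subtype.val_injective).map' _ hker
  have hzero (b : ι) (c : {c // c ≠ a}) : (f (x a)).flip (z c) (y b) = 0 := by
    have hne : ¬ (a = b ∧ b = c) := fun hab => c.2 (hab.1.trans hab.2).symm
    simp [h a b c, hne]
  have hcard := card_add_card_le_finrank h.linearIndependent_middle hindep hzero
  rw [Fintype.card_subtype_compl, Fintype.card_subtype_eq] at hcard
  omega

end IsUnitSystem

theorem surjective_pi_of_linearIndependent [Finite ι] {φ : ι → Module.Dual k M₁}
    (hφ : LinearIndependent k φ) : Function.Surjective (LinearMap.pi φ) := by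
  have hspan := span_flip_eq_top_iff_linearIndependent.2
    (hφ.map' (LinearMap.ltoFun k M₁ k k) (LinearMap.ker_eq_bot.2 DFunLike.coe_injective))
  rwa [← LinearMap.range_eq_top, ← Submodule.span_eq (LinearMap.range (LinearMap.pi φ))]

theorem exists_forall_apply_eq_of_linearIndependent [Finite ι]
    {f : M₁ →ₗ[k] M₂ →ₗ[k] M₃ →ₗ[k] k} {x : ι → M₁} {z : ι → M₃}
    (h : LinearIndependent k fun p : ι × ι => (f (x p.1)).flip (z p.2)) (X : ι → ι → ι → k) :
    ∃ y : ι → M₂, ∀ a b c, f (x a) (y b) (z c) = X a b c := by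
  choose y hy using fun b => surjective_pi_of_linearIndependent h fun p => X p.1 b p.2
  exact ⟨y, fun a b c => congrFun (hy b) (a, c)⟩

theorem finite_setOf_not_linearIndependent_add_smul [Finite ι] {w : ι → M₁}
    (hw : LinearIndependent k w) (v : ι → M₁) :
    {t : k | ¬ LinearIndependent k (v + t • w)}.Finite := by
  classical
  have := Fintype.ofFinite ι
  obtain ⟨L, hL⟩ := LinearMap.exists_leftInverse_of_injective (Fintype.linearCombination k w)
    (LinearMap.ker_eq_bot.2 hw.fintypeLinearCombination_injective)
  have hLw (i : ι) : L (w i) = Pi.single i 1 := by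
    simpa using LinearMap.congr_fun hL (Pi.single i 1)
  let e : Module.End k (ι → k) := L ∘ₗ Fintype.linearCombination k v
  refine (e.finite_spectrum.preimage neg_injective.injOn).subset fun t => ?_
  contrapose
  intro ht
  have hinj : LinearMap.ker (algebraMap k (Module.End k (ι → k)) (-t) - e) = ⊥ :=
    (LinearMap.isUnit_iff_ker_eq_bot _).1 (spectrum.notMem_iff.1 ht)
  have hcomp : ⇑(-L) ∘ (v + t • w) =
      (algebraMap k (Module.End k (ι → k)) (-t) - e) ∘ fun i => Pi.single i 1 := by
    ext1 i
    simp only [Function.comp_apply, LinearMap.neg_apply, Pi.add_apply, Pi.smul_apply, map_add,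
      map_smul, hLw, e, LinearMap.sub_apply, Module.algebraMap_end_apply, LinearMap.comp_apply,
      Fintype.linearCombination_apply_single, one_smul]
    module
  rw [Set.mem_ofPred_eq, not_not]
  refine LinearIndependent.of_comp (-L) ?_
  rw [hcomp]
  exact (Pi.linearIndependent_single_one ι k).map' _ hinj

end UnitSystem

open scoped RealInnerProductSpace Quaternion

section TensorForm

variable {E₁ E₂ E₃ : Type*} [NormedAddCommGroup E₁] [InnerProductSpace ℝ E₁]
  [NormedAddCommGroup E₂] [InnerProductSpace ℝ E₂] [NormedAddCommGroup E₃] [InnerProductSpace ℝ E₃]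

/-- The trilinear form of a real tensor of order three: the inner product with pure tensors. -/
noncomputable def tensorForm (T : (E₁ ⊗[ℝ] E₂) ⊗[ℝ] E₃) : E₁ →ₗ[ℝ] E₂ →ₗ[ℝ] E₃ →ₗ[ℝ] ℝ :=
  TensorProduct.curry (TensorProduct.curry (innerₗ _ T))

@[simp]
theorem tensorForm_apply (T : (E₁ ⊗[ℝ] E₂) ⊗[ℝ] E₃) (x : E₁) (y : E₂) (z : E₃) :
    tensorForm T x y z = ⟪T, (x ⊗ₜ y) ⊗ₜ z⟫ := rfl

theorem exists_eq_pi_inner {E ι : Type*} [NormedAddCommGroup E] [InnerProductSpace ℝ E]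
    [FiniteDimensional ℝ E] (φ : E →ₗ[ℝ] ι → ℝ) :
    ∃ x : ι → E, φ = LinearMap.pi fun a => innerₗ _ (x a) := by
  have := FiniteDimensional.complete ℝ E
  refine ⟨fun a => (InnerProductSpace.toDual ℝ E).symm
    (LinearMap.toContinuousLinearMap (LinearMap.proj a ∘ₗ φ)), ?_⟩
  ext v a
  simp

/-- The standard basis of `k^r ⊗ k^r ⊗ k^r`, used to compare tensors with the unit tensor. -/
noncomputable abbrev cubeBasis (k : Type*) [Field k] (r : ℕ) :
    Module.Basis ((Fin r × Fin r) × Fin r) k (((Fin r → k) ⊗[k] (Fin r → k)) ⊗[k] (Fin r → k)) :=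
  ((Pi.basisFun k (Fin r)).tensorProduct (Pi.basisFun k (Fin r))).tensorProduct
    (Pi.basisFun k (Fin r))

theorem cubeBasis_repr_unitTensor (k : Type*) [Field k] {r : ℕ} (a b c : Fin r) :
    (cubeBasis k r).repr (unitTensor k r) ((a, b), c) = if a = b ∧ b = c then 1 else 0 := by
  rw [unitTensor, map_sum, Finsupp.finsetSum_apply]
  rcases eq_or_ne a b with rfl | hab
  · simp [Pi.single_apply, eq_comm]
  · simp [Pi.single_apply, hab, eq_comm]

theorem cubeBasis_repr_map_pi_inner {r : ℕ} (x : Fin r → E₁) (y : Fin r → E₂) (z : Fin r → E₃)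
    (T : (E₁ ⊗[ℝ] E₂) ⊗[ℝ] E₃) (a b c : Fin r) :
    (cubeBasis ℝ r).repr (TensorProduct.map (TensorProduct.map
      (LinearMap.pi fun a => innerₗ _ (x a)) (LinearMap.pi fun b => innerₗ _ (y b)))
      (LinearMap.pi fun c => innerₗ _ (z c)) T) ((a, b), c) =
    tensorForm T (x a) (y b) (z c) := by
  rw [← Module.Basis.coord_apply, ← LinearMap.comp_apply]
  refine (LinearMap.congr_fun (TensorProduct.ext_threefold fun u v w => ?_) T).trans
    (real_inner_comm T ((x a ⊗ₜ[ℝ] y b) ⊗ₜ[ℝ] z c) : innerₗ _ ((x a ⊗ₜ y b) ⊗ₜ z c) T = _)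
  simp [mul_comm, mul_assoc]

theorem restrictsToUnit_iff [FiniteDimensional ℝ E₁] [FiniteDimensional ℝ E₂]
    [FiniteDimensional ℝ E₃] {T : (E₁ ⊗[ℝ] E₂) ⊗[ℝ] E₃} {r : ℕ} :
    RestrictsToUnit T r ↔ ∃ (x : Fin r → E₁) (y : Fin r → E₂) (z : Fin r → E₃),
      IsUnitSystem (tensorForm T) x y z := by
  constructor
  · rintro ⟨φ₁, φ₂, φ₃, h⟩
    obtain ⟨x, rfl⟩ := exists_eq_pi_inner φ₁
    obtain ⟨y, rfl⟩ := exists_eq_pi_inner φ₂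
    obtain ⟨z, rfl⟩ := exists_eq_pi_inner φ₃
    exact ⟨x, y, z, fun a b c => by
      rw [← cubeBasis_repr_map_pi_inner, h, cubeBasis_repr_unitTensor]⟩
  · rintro ⟨x, y, z, h⟩
    refine ⟨LinearMap.pi fun a => innerₗ _ (x a), LinearMap.pi fun b => innerₗ _ (y b),
      LinearMap.pi fun c => innerₗ _ (z c), (cubeBasis ℝ r).ext_elem fun ⟨⟨a, b⟩, c⟩ => ?_⟩
    rw [cubeBasis_repr_map_pi_inner, cubeBasis_repr_unitTensor, h]

section Subrank

variable [FiniteDimensional ℝ E₁] [FiniteDimensional ℝ E₂] [FiniteDimensional ℝ E₃]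
  {T : (E₁ ⊗[ℝ] E₂) ⊗[ℝ] E₃}

theorem le_subrank_iff {r : ℕ} : r ≤ subrank T ↔
    ∃ (x : Fin r → E₁) (y : Fin r → E₂) (z : Fin r → E₃), IsUnitSystem (tensorForm T) x y z := by
  refine ⟨fun hr => ?_, fun h => (subrank_isGreatest T).2 (restrictsToUnit_iff.2 h)⟩
  obtain ⟨x, y, z, hxyz⟩ := restrictsToUnit_iff.1 (subrank_isGreatest T).1
  exact ⟨_, _, _, hxyz.comp_injective (Fin.castLE_injective hr)⟩

theorem subrank_le_finrank_left : subrank T ≤ Module.finrank ℝ E₁ := by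
  obtain ⟨x, y, z, hxyz⟩ := le_subrank_iff.1 (le_refl (subrank T))
  simpa using hxyz.linearIndependent_left.fintype_card_le_finrank

theorem two_mul_subrank_le (hT : IsNonsingular (tensorForm T)) :
    2 * subrank T ≤ Module.finrank ℝ E₂ + 1 := by
  obtain ⟨x, y, z, hxyz⟩ := le_subrank_iff.1 (le_refl (subrank T))
  simpa using hxyz.two_mul_card_le hT

end Subrank

section Nonsingular

variable [FiniteDimensional ℝ E₁] [FiniteDimensional ℝ E₂] [FiniteDimensional ℝ E₃]

theorem tensorForm_surjective :
    Function.Surjective (tensorForm : (E₁ ⊗[ℝ] E₂) ⊗[ℝ] E₃ → E₁ →ₗ[ℝ] E₂ →ₗ[ℝ] E₃ →ₗ[ℝ] ℝ) := by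
  intro f
  have := FiniteDimensional.complete ℝ ((E₁ ⊗[ℝ] E₂) ⊗[ℝ] E₃)
  refine ⟨(InnerProductSpace.toDual ℝ _).symm (LinearMap.toContinuousLinearMap
    (TensorProduct.lift (TensorProduct.lift f))), ?_⟩
  ext x y z
  simp

theorem exists_isNonsingular_tensorForm (A : Type*) [Ring A] [NoZeroDivisors A] [Algebra ℝ A]
    [FiniteDimensional ℝ A] (h₁ : Module.finrank ℝ E₁ ≤ Module.finrank ℝ A)
    (h₂ : Module.finrank ℝ A ≤ Module.finrank ℝ E₂)
    (h₃ : Module.finrank ℝ E₃ ≤ Module.finrank ℝ A) :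
    ∃ T : (E₁ ⊗[ℝ] E₂) ⊗[ℝ] E₃, IsNonsingular (tensorForm T) := by
  obtain ⟨i, hi⟩ := finrank_le_iff_exists_linearMap.1 h₁
  obtain ⟨j, hj⟩ := finrank_le_iff_exists_linearMap.1 h₂
  obtain ⟨l, hl⟩ := finrank_le_iff_exists_linearMap.1 h₃
  obtain ⟨T, hT⟩ := tensorForm_surjective (LinearMap.lflip.toLinearMap ∘ₗ
    (((LinearMap.mul ℝ A).compl₁₂ i l).compr₂ j).compr₂ (innerₗ E₂))
  refine ⟨T, fun x hx z hz => ?_⟩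
  have hT_apply (y : E₂) : tensorForm T x y z = ⟪j (i x * l z), y⟫ := by rw [hT]; rfl
  have hmul : i x * l z = 0 := by
    rw [← map_eq_zero_iff j hj, ← inner_self_eq_zero (𝕜 := ℝ), ← hT_apply, hz]
  refine (map_eq_zero_iff l hl).1 ((mul_eq_zero.1 hmul).resolve_left ?_)
  rwa [map_eq_zero_iff i hi]

end Nonsingular

end TensorForm

section Topology

open Filter Topology

theorem eventually_exists_eq_of_surjective_partial {E P G : Type*} [NormedAddCommGroup E]
    [NormedSpace ℝ E] [CompleteSpace E] [NormedAddCommGroup P] [NormedSpace ℝ P] [CompleteSpace P]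
    [NormedAddCommGroup G] [NormedSpace ℝ G] [CompleteSpace G] {F : E × P → G}
    {F' : E × P →L[ℝ] G} {e₀ : E} {p₀ : P} (hF : HasStrictFDerivAt F F' (e₀, p₀))
    (hsurj : ∀ g, ∃ v, F' (v, 0) = g) : ∀ᶠ p in 𝓝 p₀, ∃ e, F (e, p) = F (e₀, p₀) := by
  have hpair := hF.prodMk (hasStrictFDerivAt_snd (p := (e₀, p₀)) (𝕜 := ℝ))
  have hrange : (F'.prod (ContinuousLinearMap.snd ℝ E P)).range = ⊤ := by
    refine LinearMap.range_eq_top.2 fun ⟨g, p⟩ => ?_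
    obtain ⟨v, hv⟩ := hsurj (g - F' (0, p))
    refine ⟨(v, 0) + (0, p), ?_⟩
    rw [ContinuousLinearMap.coe_coe, map_add]
    simp [hv]
  have hmem : Set.range (fun q : E × P => (F q, q.2)) ∈ 𝓝 (F (e₀, p₀), p₀) := by
    rw [← hpair.map_nhds_eq_of_surj hrange]
    exact range_mem_map
  have hcont : Continuous fun p : P => (F (e₀, p₀), p) := by fun_prop
  filter_upwards [hcont.continuousAt hmem] with p ⟨⟨e, p'⟩, hep⟩
  obtain ⟨hFe, rfl⟩ := Prod.ext_iff.1 hep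
  exact ⟨e, hFe⟩

section TrilinearForm

variable {ι E₁ E₂ E₃ : Type*} [Finite ι] [NormedAddCommGroup E₁] [NormedSpace ℝ E₁]
  [NormedAddCommGroup E₂] [NormedSpace ℝ E₂] [NormedAddCommGroup E₃] [NormedSpace ℝ E₃]

theorem exists_hasStrictFDerivAt_trilinear (x : ι → E₁) (y : ι → E₂) (z : ι → E₃)
    (f : E₁ →L[ℝ] E₂ →L[ℝ] E₃ →L[ℝ] ℝ) (a b c : ι) :
    ∃ F' : ((ι → E₁) × (ι → E₂) × (ι → E₃)) × (E₁ →L[ℝ] E₂ →L[ℝ] E₃ →L[ℝ] ℝ) →L[ℝ] ℝ,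
      HasStrictFDerivAt (fun q : ((ι → E₁) × (ι → E₂) × (ι → E₃)) ×
          (E₁ →L[ℝ] E₂ →L[ℝ] E₃ →L[ℝ] ℝ) => q.2 (q.1.1 a) (q.1.2.1 b) (q.1.2.2 c))
        F' ((x, y, z), f) ∧
      ∀ u v w, F' ((u, v, w), 0) =
        f (u a) (y b) (z c) + f (x a) (v b) (z c) + f (x a) (y b) (w c) := by
  have := Fintype.ofFinite ι
  have hxyz := hasStrictFDerivAt_fst (𝕜 := ℝ) (p := ((x, y, z), f))
  have hx := (hasStrictFDerivAt_pi'.1 hxyz.fst) a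
  have hy := (hasStrictFDerivAt_pi'.1 hxyz.snd.fst) b
  have hz := (hasStrictFDerivAt_pi'.1 hxyz.snd.snd) c
  refine ⟨_, ((hasStrictFDerivAt_snd.clm_apply hx).clm_apply hy).clm_apply hz, fun u v w => ?_⟩
  simp only [ContinuousLinearMap.flip_add, add_apply, ContinuousLinearMap.comp_apply,
    ContinuousLinearMap.coe_fst', ContinuousLinearMap.coe_snd', ContinuousLinearMap.proj_apply,
    ContinuousLinearMap.flip_apply, zero_apply, add_zero]
  ring

theorem eventually_exists_trilinear_eq [CompleteSpace E₁] [CompleteSpace E₂] [CompleteSpace E₃]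
    {f₀ : E₁ →L[ℝ] E₂ →L[ℝ] E₃ →L[ℝ] ℝ} {x₀ : ι → E₁} {y₀ : ι → E₂} {z₀ : ι → E₃}
    (hsurj : ∀ X : ι → ι → ι → ℝ, ∃ (u : ι → E₁) (v : ι → E₂) (w : ι → E₃), ∀ a b c,
      f₀ (u a) (y₀ b) (z₀ c) + f₀ (x₀ a) (v b) (z₀ c) + f₀ (x₀ a) (y₀ b) (w c) = X a b c) :
    ∀ᶠ f in 𝓝 f₀, ∃ (x : ι → E₁) (y : ι → E₂) (z : ι → E₃),
      ∀ a b c, f (x a) (y b) (z c) = f₀ (x₀ a) (y₀ b) (z₀ c) := by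
  have := Fintype.ofFinite ι
  choose F' hF' hF'_apply using exists_hasStrictFDerivAt_trilinear x₀ y₀ z₀ f₀
  have hF := hasStrictFDerivAt_pi.2 fun a => hasStrictFDerivAt_pi.2 fun b =>
    hasStrictFDerivAt_pi.2 (hF' a b)
  have hF'_surj (X : ι → ι → ι → ℝ) : ∃ e, ContinuousLinearMap.pi (fun a =>
      ContinuousLinearMap.pi fun b => ContinuousLinearMap.pi (F' a b)) (e, 0) = X := by
    obtain ⟨u, v, w, huvw⟩ := hsurj X
    refine ⟨(u, v, w), ?_⟩
    ext a b c
    simp [hF'_apply, huvw]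
  filter_upwards [eventually_exists_eq_of_surjective_partial hF hF'_surj] with f ⟨e, he⟩
  exact ⟨e.1, e.2.1, e.2.2, fun a b c => congrFun (congrFun (congrFun he a) b) c⟩

end TrilinearForm

variable {E₁ E₂ E₃ : Type*} [NormedAddCommGroup E₁] [InnerProductSpace ℝ E₁]
  [NormedAddCommGroup E₂] [InnerProductSpace ℝ E₂] [NormedAddCommGroup E₃] [InnerProductSpace ℝ E₃]

theorem exists_continuous_eq_tensorForm :
    ∃ Φ : (E₁ ⊗[ℝ] E₂) ⊗[ℝ] E₃ → E₁ →L[ℝ] E₂ →L[ℝ] E₃ →L[ℝ] ℝ,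
      Continuous Φ ∧ ∀ T x y z, Φ T x y z = tensorForm T x y z := by
  refine ⟨fun T => ContinuousLinearMap.compL ℝ E₂ _ _ (ContinuousLinearMap.compL ℝ E₃ _ ℝ
    (innerSL ℝ T) ∘L TensorProduct.mkL ℝ (E₁ ⊗[ℝ] E₂) E₃) ∘L TensorProduct.mkL ℝ E₁ E₂, ?_,
    fun T x y z => rfl⟩
  fun_prop

theorem isOpen_setOf_isNonsingular [FiniteDimensional ℝ E₁] [FiniteDimensional ℝ E₃] :
    IsOpen {T : (E₁ ⊗[ℝ] E₂) ⊗[ℝ] E₃ | IsNonsingular (tensorForm T)} := by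
  obtain ⟨Φ, hΦ, hΦ_apply⟩ := exists_continuous_eq_tensorForm (E₁ := E₁) (E₂ := E₂) (E₃ := E₃)
  refine isOpen_iff_eventually.2 fun T₀ hT₀ => ?_
  have hsphere : ∀ᶠ T in 𝓝 T₀, ∀ p ∈ Metric.sphere (0 : E₁) 1 ×ˢ Metric.sphere (0 : E₃) 1,
      ∃ y, Φ T p.1 y p.2 ≠ 0 := by
    refine ((isCompact_sphere _ _).prod
      (isCompact_sphere _ _)).eventually_forall_of_forall_eventually fun p ⟨hx, hz⟩ => ?_
    obtain ⟨y, hy⟩ : ∃ y, Φ T₀ p.1 y p.2 ≠ 0 := by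
      by_contra! h
      exact ne_zero_of_mem_unit_sphere ⟨_, hz⟩
        (hT₀ _ (ne_zero_of_mem_unit_sphere ⟨_, hx⟩) _ fun y => (hΦ_apply ..).symm.trans (h y))
    have hcont : Continuous fun q : ((E₁ ⊗[ℝ] E₂) ⊗[ℝ] E₃) × (E₁ × E₃) =>
        Φ q.1 q.2.1 y q.2.2 := by fun_prop
    filter_upwards [hcont.continuousAt.eventually_ne hy] with q hq using ⟨y, hq⟩
  filter_upwards [hsphere] with T hT x hx z hz
  by_contra hz0
  obtain ⟨y, hy⟩ := hT (‖x‖⁻¹ • x, ‖z‖⁻¹ • z)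
    ⟨by simp [norm_smul, hx], by simp [norm_smul, hz0]⟩
  rw [hΦ_apply] at hy
  simp [hz y] at hy

theorem IsUnitSystem.eventually_le_subrank [FiniteDimensional ℝ E₁] [FiniteDimensional ℝ E₂]
    [FiniteDimensional ℝ E₃] {T₀ : (E₁ ⊗[ℝ] E₂) ⊗[ℝ] E₃} {r : ℕ} {x : Fin r → E₁}
    {y : Fin r → E₂} {z : Fin r → E₃} (h : IsUnitSystem (tensorForm T₀) x y z)
    (hsurj : ∀ X : Fin r → Fin r → Fin r → ℝ,
      ∃ (u : Fin r → E₁) (v : Fin r → E₂) (w : Fin r → E₃), ∀ a b c,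
      tensorForm T₀ (u a) (y b) (z c) + tensorForm T₀ (x a) (v b) (z c) +
        tensorForm T₀ (x a) (y b) (w c) = X a b c) :
    ∀ᶠ T in 𝓝 T₀, r ≤ subrank T := by
  have := FiniteDimensional.complete ℝ E₁
  have := FiniteDimensional.complete ℝ E₂
  have := FiniteDimensional.complete ℝ E₃
  obtain ⟨Φ, hΦ, hΦ_apply⟩ := exists_continuous_eq_tensorForm (E₁ := E₁) (E₂ := E₂) (E₃ := E₃)
  simp only [← hΦ_apply] at hsurj
  filter_upwards [hΦ.continuousAt.eventually (eventually_exists_trilinear_eq hsurj)]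
    with T ⟨u, v, w, hT⟩
  refine le_subrank_iff.2 ⟨u, v, w, fun a b c => ?_⟩
  rw [← hΦ_apply, hT, hΦ_apply, h]

section Density

variable [FiniteDimensional ℝ E₁] [FiniteDimensional ℝ E₂] [FiniteDimensional ℝ E₃] {r : ℕ}

theorem eventually_le_subrank_of_linearIndependent {T : (E₁ ⊗[ℝ] E₂) ⊗[ℝ] E₃}
    {x : Fin r → E₁} {z : Fin r → E₃}
    (h : LinearIndependent ℝ fun p : Fin r × Fin r => (tensorForm T (x p.1)).flip (z p.2)) :
    ∀ᶠ S in 𝓝 T, r ≤ subrank S := by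
  obtain ⟨y, hy⟩ := exists_forall_apply_eq_of_linearIndependent h
    fun a b c => if a = b ∧ b = c then 1 else 0
  refine IsUnitSystem.eventually_le_subrank (x := x) (z := z) hy fun X => ?_
  obtain ⟨v, hv⟩ := exists_forall_apply_eq_of_linearIndependent h X
  exact ⟨0, v, 0, fun a b c => by simpa using hv a b c⟩

theorem exists_orthonormal_of_card_le_finrank {E ι : Type*} [NormedAddCommGroup E]
    [InnerProductSpace ℝ E] [FiniteDimensional ℝ E] [Fintype ι]
    (h : Fintype.card ι ≤ Module.finrank ℝ E) : ∃ v : ι → E, Orthonormal ℝ v := by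
  obtain ⟨e⟩ := Function.Embedding.nonempty_of_card_le (h.trans_eq (Fintype.card_fin _).symm)
  exact ⟨_, (stdOrthonormalBasis ℝ E).orthonormal.comp e e.injective⟩

theorem exists_linearIndependent_tensorForm (h₁ : r ≤ Module.finrank ℝ E₁)
    (h₂ : r ^ 2 ≤ Module.finrank ℝ E₂) (h₃ : r ≤ Module.finrank ℝ E₃) :
    ∃ (T : (E₁ ⊗[ℝ] E₂) ⊗[ℝ] E₃) (x : Fin r → E₁) (z : Fin r → E₃),
      LinearIndependent ℝ fun p : Fin r × Fin r => (tensorForm T (x p.1)).flip (z p.2) := by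
  obtain ⟨x, hx⟩ := exists_orthonormal_of_card_le_finrank (ι := Fin r) (by simpa using h₁)
  obtain ⟨y, hy⟩ := exists_orthonormal_of_card_le_finrank (ι := Fin r × Fin r)
    (by simpa [← sq] using h₂)
  obtain ⟨z, hz⟩ := exists_orthonormal_of_card_le_finrank (ι := Fin r) (by simpa using h₃)
  have hker : LinearMap.ker (innerₗ E₂) = ⊥ :=
    LinearMap.ker_eq_bot'.2 fun v hv => inner_self_eq_zero.1 (LinearMap.congr_fun hv v)
  have hslices : innerₗ E₂ ∘ y = fun p => (tensorForm (∑ q : Fin r × Fin r,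
      (x q.1 ⊗ₜ[ℝ] y q) ⊗ₜ[ℝ] z q.2) (x p.1)).flip (z p.2) := by
    ext p v
    simp [sum_inner, orthonormal_iff_ite.1 hx, orthonormal_iff_ite.1 hz, Fintype.sum_prod_type]
  exact ⟨_, x, z, hslices ▸ hy.linearIndependent.map' (innerₗ E₂) hker⟩

theorem dense_interior_setOf_le_subrank (h₁ : r ≤ Module.finrank ℝ E₁)
    (h₂ : r ^ 2 ≤ Module.finrank ℝ E₂) (h₃ : r ≤ Module.finrank ℝ E₃) :
    Dense (interior {T : (E₁ ⊗[ℝ] E₂) ⊗[ℝ] E₃ | r ≤ subrank T}) := by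
  obtain ⟨T₁, x, z, hT₁⟩ := exists_linearIndependent_tensorForm h₁ h₂ h₃
  intro T
  have hdense := (finite_setOf_not_linearIndependent_add_smul hT₁
    fun p => (tensorForm T (x p.1)).flip (z p.2)).countable.dense_compl ℝ
  have hcont : Continuous fun t : ℝ => T + t • T₁ := by fun_prop
  have hslices (t : ℝ) : ((fun p : Fin r × Fin r => (tensorForm T (x p.1)).flip (z p.2)) +
      t • fun p => (tensorForm T₁ (x p.1)).flip (z p.2)) =
      fun p => (tensorForm (T + t • T₁) (x p.1)).flip (z p.2) := by
    ext p v
    simp [inner_add_left, inner_smul_left]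
  have hmem := map_mem_closure hcont (hdense 0) fun t ht => mem_interior_iff_mem_nhds.2
    (eventually_le_subrank_of_linearIndependent (hslices t ▸ not_not.1 ht))
  simpa using hmem

end Density

end Topology

section StableTensor

/-- A `3 × 4 × 4` tensor whose restriction to the first three coordinates is the unit tensor. The
terms involving the last coordinates are added so that infinitesimal changes of the vectors
realizing this restriction reach every `3 × 3 × 3` tensor. -/
noncomputable def stableTensor : RealTensor 3 4 4 :=
  ∑ a : Fin 3,
    ((EuclideanSpace.single a 1 ⊗ₜ EuclideanSpace.single a.castSucc 1) ⊗ₜ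
        EuclideanSpace.single a.castSucc 1 +
      (EuclideanSpace.single a 1 ⊗ₜ EuclideanSpace.single (a + 2).castSucc 1) ⊗ₜ
        EuclideanSpace.single (Fin.last 3) 1 +
      (EuclideanSpace.single a 1 ⊗ₜ EuclideanSpace.single (Fin.last 3) 1) ⊗ₜ
        EuclideanSpace.single (a + 2).castSucc 1)

theorem tensorForm_stableTensor (x : EuclideanSpace ℝ (Fin 3)) (y z : EuclideanSpace ℝ (Fin 4)) :
    tensorForm stableTensor x y z = ∑ a : Fin 3, x a * (y a.castSucc * z a.castSucc +
      y (a + 2).castSucc * z (Fin.last 3) + y (Fin.last 3) * z (a + 2).castSucc) := by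
  simp only [tensorForm_apply, stableTensor, sum_inner, inner_add_left, TensorProduct.inner_tmul,
    EuclideanSpace.inner_single_left, map_one, one_mul]
  exact Finset.sum_congr rfl fun a _ => by ring

theorem isUnitSystem_stableTensor :
    IsUnitSystem (tensorForm stableTensor) (fun a : Fin 3 => EuclideanSpace.single a 1)
      (fun b => EuclideanSpace.single b.castSucc 1)
      (fun c => EuclideanSpace.single c.castSucc 1) := by
  intro a b c
  rw [tensorForm_stableTensor]
  fin_cases a <;> fin_cases b <;> fin_cases c <;> simp [Fin.sum_univ_three]

theorem exists_variation_stableTensor (X : Fin 3 → Fin 3 → Fin 3 → ℝ) :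
    ∃ (u : Fin 3 → EuclideanSpace ℝ (Fin 3)) (v w : Fin 3 → EuclideanSpace ℝ (Fin 4)), ∀ a b c,
      tensorForm stableTensor (u a) (EuclideanSpace.single b.castSucc 1)
          (EuclideanSpace.single c.castSucc 1) +
        tensorForm stableTensor (EuclideanSpace.single a 1) (v b)
          (EuclideanSpace.single c.castSucc 1) +
        tensorForm stableTensor (EuclideanSpace.single a 1)
          (EuclideanSpace.single b.castSucc 1) (w c) = X a b c := by
  -- The last coordinates of `v` and `w` take care of the entries `X a b c` with distinct indices,
  -- their other coordinates of those with `a = c ≠ b` and `a = b ≠ c`, and `u` of those with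
  -- `b = c`.
  let β (b : Fin 3) : ℝ := X (b + 2) b (b + 1)
  let γ (c : Fin 3) : ℝ := X (c + 2) (c + 1) c
  refine ⟨fun a => WithLp.toLp 2 fun b => X a b b - if b = a + 2 then β b + γ b else 0,
    fun b => WithLp.toLp 2 (Fin.snoc (α := fun _ => ℝ)
      (fun a => if a = b then 0 else X a b a - if b = a + 2 then γ a else 0) (β b)),
    fun c => WithLp.toLp 2 (Fin.snoc (α := fun _ => ℝ)
      (fun a => if a = c then 0 else X a a c - if c = a + 2 then β a else 0) (γ c)),
    fun a b c => ?_⟩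
  simp only [tensorForm_stableTensor, Fin.snoc_castSucc, Fin.snoc_last, β, γ]
  fin_cases a <;> fin_cases b <;> fin_cases c <;> simp [Fin.sum_univ_three] <;> ring

end StableTensor

section Typical

theorem le_of_isTypicalSubrank {n₁ n₂ n₃ r s : ℕ} (h₁ : r ≤ n₁) (h₂ : r ^ 2 ≤ n₂) (h₃ : r ≤ n₃)
    (hs : IsTypicalSubrank n₁ n₂ n₃ s) : r ≤ s := by
  obtain ⟨U, hU, hUne, hUs⟩ := hs
  have hdense : Dense (interior {T : RealTensor n₁ n₂ n₃ | r ≤ subrank T}) :=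
    dense_interior_setOf_le_subrank (by simpa using h₁) (by simpa using h₂) (by simpa using h₃)
  obtain ⟨T, hTU, hT⟩ := hdense.inter_open_nonempty U hU hUne
  exact (interior_subset hT).out.trans_eq (hUs hTU)

theorem IsTypicalSubrank.le_left {n₁ n₂ n₃ r : ℕ} (hr : IsTypicalSubrank n₁ n₂ n₃ r) :
    r ≤ n₁ := by
  obtain ⟨U, -, ⟨T, hT⟩, hUr⟩ := hr
  simpa using (hUr hT).symm.trans_le subrank_le_finrank_left

theorem isTypicalSubrank_two : IsTypicalSubrank 3 4 4 2 := by
  have hquat : ∃ T : RealTensor 3 4 4, IsNonsingular (tensorForm T) := by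
    apply exists_isNonsingular_tensorForm ℍ[ℝ] <;> simp [Quaternion.finrank_eq_four]
  have hdense : Dense (interior {T : RealTensor 3 4 4 | 2 ≤ subrank T}) :=
    dense_interior_setOf_le_subrank (by simp) (by simp) (by simp)
  refine ⟨_, isOpen_setOf_isNonsingular.inter isOpen_interior,
    hdense.inter_open_nonempty _ isOpen_setOf_isNonsingular hquat, fun T ⟨hT, hT₂⟩ => ?_⟩
  have hle := two_mul_subrank_le hT
  have hge : 2 ≤ subrank T := (interior_subset hT₂).out
  rw [finrank_euclideanSpace_fin] at hle
  exact le_antisymm (by omega) hge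

theorem isTypicalSubrank_three : IsTypicalSubrank 3 4 4 3 := by
  have hstable : stableTensor ∈ interior {T | 3 ≤ subrank T} := mem_interior_iff_mem_nhds.2
    (isUnitSystem_stableTensor.eventually_le_subrank exists_variation_stableTensor)
  refine ⟨_, isOpen_interior, ⟨_, hstable⟩, fun T hT => le_antisymm ?_ ?_⟩
  · simpa using subrank_le_finrank_left (T := T)
  · exact (interior_subset hT).out

end Typical

theorem corollary4p12 : {r : ℕ | IsTypicalSubrank 3 4 4 r} = {2, 3} := by
  ext r
  constructor
  · intro hr
    have hge : 2 ≤ r := le_of_isTypicalSubrank (by simp) (by simp) (by simp) hr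
    have hle : r ≤ 3 := hr.le_left
    interval_cases r <;> simp
  · rintro (rfl | rfl)
    exacts [isTypicalSubrank_two, isTypicalSubrank_three]
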